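/- For $n\in\mathbb N$ let $[n]=\{0,1,\dots,n-1\}$ with its usual order. Grid-rank. Let $X,Y$ be finite linearly ordered sets and $R\subseteq X\times Y$. A $k$-division of $R$ is a pair of ordered partitions $X=I_1\cup\dots\cup I_k$, $Y=J_1\cup\dots\cup J_k$ into nonempty parts with $I_i<I_j$ and $J_i<J_j$ (elementwise) for all $i<j$. The relation $R$ has grid-rank at least $k$ if it has a $k$-division in which every cell $I_i\times J_j$ of the $0/1$-matrix of $R$ contains at least $k$ distinct rows and at least $k$ distinct columns. It has grid-rank at most $d$ if it does not have grid-rank at least $k$ for any $k>d$. Projected grid-rank. Let $C$ be a finite index set. An ordered subset of $[n]^C$ is a set $S\subseteq[n]^C$ with a total order $s_1\prec\dots\prec s_m$ of its elements such that for each $c\in C$ the sequence $s_1[c],\dots,s_m[c]$ is strictly increasing, constant, or strictly decreasing. Let $R\subseteq[n]^k$ be a relation whose coordinate set is partitioned as $A\cup B$. For ordered subsets $S$ of $[n]^A$ and $T$ of $[n]^B$, the relation $\{(s,t)\in S\times T : s\cup t\in R\}$ on the linearly ordered sets $S$ and $T$ is called a projected grid of $R$, where $s\cup t\in[n]^k$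 is the tuple that agrees with $s$ on $A$ and with $t$ on $B$. The relation $R$ has projected grid-rank at most $d$ if, for every partition $A\cup B$ of its coordinates, every projected grid of $R$ with respect to $A \cup B$ has grid-rank at most $d$. Theorem. There is a function $f:\mathbb N\times\mathbb N\to\mathbb N$ such that for all $d,k,n\in\mathbb N$, every relation $R\subseteq[n]^k$ with projected grid-rank at most $d$, and every two distinct coordinates $i,j$ of $R$, the binary projection $\pi_{i,j}R=\{(x_i,x_j) : x\in R\}\subseteq[n]^2$ has grid-rank at most $f(d,k)$. In particular this holds for $\pi_{1,2}R$ when $k\ge 2$. -/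

import Mathlib

namespace GridRank

/-- An ordered partition `I 0 < I 1 < ⋯ < I (d-1)` of a linearly ordered set into `d` parts
(disjointness follows from the order condition). -/
def IsOrderedPartition {α : Type*} [LinearOrder α] {d : ℕ} (I : Fin d → Set α) : Prop :=
  (⋃ i, I i) = Set.univ ∧ (∀ i, (I i).Nonempty) ∧
    ∀ i j, i < j → ∀ a ∈ I i, ∀ b ∈ I j, a < b

/-- The set of distinct rows of the cell `I × J` of the 0/1-matrix of `R`;
a row is recorded as the set of its 1-positions. -/
def cellRows {α β : Type*} (R : Set (α × β)) (I : Set α) (J : Set β) : Set (Set β) :=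
  (fun a => {b | b ∈ J ∧ (a, b) ∈ R}) '' I

/-- The set of distinct columns of the cell `I × J` of the 0/1-matrix of `R`. -/
def cellCols {α β : Type*} (R : Set (α × β)) (I : Set α) (J : Set β) : Set (Set α) :=
  (fun b => {a | a ∈ I ∧ (a, b) ∈ R}) '' J

/-- `R` has grid-rank (at least) `k`: there is a `k`-division all of whose cells contain at
least `k` distinct rows and at least `k` distinct columns. -/
def HasGridRank {α β : Type*} [LinearOrder α] [LinearOrder β] (R : Set (α × β)) (k : ℕ) : Prop :=
  ∃ (I : Fin k → Set α) (J : Fin k → Set β), IsOrderedPartition I ∧ IsOrderedPartition J ∧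
    ∀ i j, (k : ℕ∞) ≤ (cellRows R (I i) (J j)).encard ∧ (k : ℕ∞) ≤ (cellCols R (I i) (J j)).encard

/-- `R` has grid-rank at most `d`. -/
def GridRankLE {α β : Type*} [LinearOrder α] [LinearOrder β] (R : Set (α × β)) (d : ℕ) : Prop :=
  ∀ e, HasGridRank R e → e ≤ d

/-- `s 0 ≺ ⋯ ≺ s (m-1)` enumerates an ordered subset of `[n]^ι`: the points are distinct, and
every coordinate is strictly increasing, constant, or strictly decreasing along the sequence. -/
def IsOrderedSubset {ι : Type*} {n m : ℕ} (s : Fin m → ι → Fin n) : Prop :=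
  Function.Injective s ∧
    ∀ j, StrictMono (fun a => s a j) ∨ (∀ a b, s a j = s b j) ∨ StrictAnti (fun a => s a j)

/-- The tuple `u ∪ v` in `[n]^r` that agrees with `u` on `A` and with `v` on the complement. -/
def glue {n r : ℕ} (A : Finset (Fin r)) (u : {x // x ∈ A} → Fin n) (v : {x // x ∉ A} → Fin n) :
    Fin r → Fin n :=
  fun x => if h : x ∈ A then u ⟨x, h⟩ else v ⟨x, h⟩

/-- The binary relation `{(s, t) ∈ S × T | s ∪ t ∈ R}`, where the elements of the
ordered sets `S` and `T` are indexed by their positions. -/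
def projectedGrid {n r p q : ℕ} (R : Set (Fin r → Fin n)) (A : Finset (Fin r))
    (s : Fin p → {x // x ∈ A} → Fin n) (t : Fin q → {x // x ∉ A} → Fin n) :
    Set (Fin p × Fin q) :=
  {x | glue A (s x.1) (t x.2) ∈ R}

/-- `R` has projected grid-rank (at least) `k`: for some partition of the coordinates into `A` and
its complement, some projected grid of `R` has grid-rank at least `k`. -/
def HasProjectedGridRank {n r : ℕ} (R : Set (Fin r → Fin n)) (k : ℕ) : Prop :=
  ∃ (A : Finset (Fin r)) (p q : ℕ)
    (s : Fin p → {x // x ∈ A} → Fin n) (t : Fin q → {x // x ∉ A} → Fin n),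
    IsOrderedSubset s ∧ IsOrderedSubset t ∧ HasGridRank (projectedGrid R A s t) k

/-- `R` has projected grid-rank at most `d`. -/
def ProjectedGridRankLE {n r : ℕ} (R : Set (Fin r → Fin n)) (d : ℕ) : Prop :=
  ∀ e, HasProjectedGridRank R e → e ≤ d

/-- The binary projection `π_{i,j} R`. -/
def binaryProjection {n r : ℕ} (i j : Fin r) (R : Set (Fin r → Fin n)) : Set (Fin n × Fin n) :=
  (fun x => (x i, x j)) '' R

end GridRank

/-!
Why projections preserve bounded projected grid-rank.

Coordinates are quantified out one at a time (`cylinder`), so that it suffices to bound the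
increase for a single coordinate `l`. A projected grid of `cylinder l R` is the projection to the
first two arguments of a ternary relation `R₃ a b z`, where `a` and `b` are positions in the two
ordered sets and `z` is the entry at `l`. If the projection has high grid-rank, the values `z` are
attached to the rows or to the columns of a suitable subgrid so that the resulting projected grid
of `R` has high grid-rank too.

The finite Ramsey theorem enters through order indiscernibles (`exists_indiscernible`). A first
use finds in a matrix of high grid-rank, or in its transpose, rows `x g a` ordered by `g` first
and columns `y g a` ordered by `a` first, such that for fixed `g` the diagonal entries all have
one value `v` and the entries above the diagonal have the opposite value (`exists_hasPattern`). In
particular each diagonal entry and its right neighbour consist of a one and a zero. Let `z g a`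
witness the one. After a second use of Ramsey, `z` is constant or strictly monotone in `g` or in
`a`, on points that differ in both coordinates (`followsFst_or_followsSnd`). If `a` does not
govern `z`, then `z` can be attached to the rows, otherwise to the columns.

In the new matrix one of the two entries at each point still is one and the other still is zero,
because a zero of the projection is a zero for all `z`, whereas all entries at points that are
later in both coordinates agree by indiscernibility. So one of the two choices of columns makes
each row distinguish its own point from those later points. Restricted to the points of the graph
of `swapDigits`, a permutation with an increasing sequence of length `m` in each cell of an `m ×
m` division, the matrix has triangular cells, which have `m` distinct rows and columns
(`hasGridRank_of_triangular`).
-/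

namespace GridRank

/-! ### Finite Ramsey theorem -/

/-- Ramsey's theorem for colourings of `r`-element subsets, in the form that every large
finite set of natural numbers contains a homogeneous subset of size `m`. -/
theorem exists_ramsey (κ : Type) [Finite κ] (r : ℕ) : ∀ m : ℕ, ∃ N : ℕ, ∀ (c : Finset ℕ → κ)
    (S : Finset ℕ), N ≤ S.card → ∃ H ⊆ S, H.card = m ∧ ∃ k, ∀ T ⊆ H, T.card = r → c T = k := by
  have := Fintype.ofFinite κ
  classical
  induction r with
  | zero =>
    intro m
    refine ⟨m, fun c S hS => ?_⟩
    obtain ⟨H, hH, hc⟩ := Finset.exists_subset_card_eq hS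
    refine ⟨H, hH, hc, c ∅, fun T _ hT => ?_⟩
    rw [Finset.card_eq_zero.1 hT]
  | succ r ih =>
    -- Sets in which the colour of a subset is determined by its least element.
    have pre : ∀ L : ℕ, ∃ N : ℕ, ∀ (c : Finset ℕ → κ) (S : Finset ℕ), N ≤ S.card →
        ∃ A ⊆ S, A.card = L ∧ ∃ col : ℕ → κ, ∀ x ∈ A, ∀ T ⊆ A, (∀ y ∈ T, x < y) →
          T.card = r → c (insert x T) = col x := by
      intro L
      induction L with
      | zero =>
        refine ⟨0, fun c S _ => ⟨∅, by simp, rfl, fun x => c {x}, by simp⟩⟩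
      | succ L ihL =>
        obtain ⟨N, hN⟩ := ihL
        obtain ⟨N', hN'⟩ := ih N
        refine ⟨N' + 1, fun c S hS => ?_⟩
        have hne : S.Nonempty := Finset.card_pos.1 (by omega)
        set x := S.min' hne with hx
        have hxS : x ∈ S := Finset.min'_mem _ _
        obtain ⟨H, hHS, hHc, k, hk⟩ := hN' (fun T => c (insert x T)) (S.erase x)
          (by rw [Finset.card_erase_of_mem hxS]; omega)
        obtain ⟨A, hAH, hAc, col, hcol⟩ := hN c H hHc.ge
        have hlt : ∀ y ∈ A, x < y := fun y hy =>
          Finset.min'_lt_of_mem_erase_min' _ hne (hHS (hAH hy))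
        have hxA : x ∉ A := fun h => lt_irrefl _ (hlt x h)
        refine ⟨insert x A, ?_, by rw [Finset.card_insert_of_notMem hxA, hAc],
          fun y => if y = x then k else col y, ?_⟩
        · exact Finset.insert_subset hxS
            ((hAH.trans hHS).trans (Finset.erase_subset _ _))
        · intro y hy T hT hyT hTc
          have hTA : T ⊆ A := by
            intro t ht
            rcases Finset.mem_insert.1 (hT ht) with rfl | h
            · rcases Finset.mem_insert.1 hy with h' | h'
              · exact absurd (hyT _ ht) (by rw [h']; exact lt_irrefl _)
              · exact absurd (hyT _ ht) (hlt y h').not_gt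
            · exact h
          rcases Finset.mem_insert.1 hy with rfl | h
          · simpa using hk T (hTA.trans hAH) hTc
          · simp only [if_neg (hlt y h).ne']
            exact hcol y h T hTA hyT hTc
    intro m
    obtain ⟨N, hN⟩ := pre (Fintype.card κ * m)
    refine ⟨N, fun c S hS => ?_⟩
    obtain ⟨A, hAS, hAc, col, hcol⟩ := hN c S hS
    have : Nonempty κ := ⟨c ∅⟩
    obtain ⟨k, -, hk⟩ := Finset.exists_le_card_fiber_of_mul_le_card_of_maps_to
      (s := A) (t := (Finset.univ : Finset κ)) (f := col) (n := m)
      (fun _ _ => Finset.mem_univ _) Finset.univ_nonempty (by rw [hAc, Finset.card_univ])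
    obtain ⟨H, hH, hHc⟩ := Finset.exists_subset_card_eq hk
    have hHA : H ⊆ A := hH.trans (Finset.filter_subset _ _)
    refine ⟨H, hHA.trans hAS, hHc, k, fun T hT hTc => ?_⟩
    have hne : T.Nonempty := Finset.card_pos.1 (by omega)
    have hmem := Finset.min'_mem T hne
    have := hcol (T.min' hne) (hHA (hT hmem)) (T.erase (T.min' hne))
      (((Finset.erase_subset _ _).trans hT).trans hHA)
      (fun y hy => Finset.min'_lt_of_mem_erase_min' _ hne hy)
      (by rw [Finset.card_erase_of_mem hmem]; omega)
    rw [Finset.insert_erase hmem] at this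
    rw [this]
    exact (Finset.mem_filter.1 (hH (hT hmem))).2

/-- The position of the value `u t` among the distinct values of `u`. A value is counted at the
first index where it occurs, so the definition mentions only the order type of `u`. -/
def rankOf {q : ℕ} (u : Fin q → ℕ) (t : Fin q) : ℕ :=
  (Finset.univ.filter fun s : Fin q =>
    u s < u t ∧ ∀ s' < s, u s' < u s ∨ u s < u s').card

theorem rankOf_congr {q : ℕ} {u v : Fin q → ℕ} (h : ∀ s t, u s < u t ↔ v s < v t) :
    rankOf u = rankOf v := by
  funext t
  simp only [rankOf, h]

theorem rankOf_lt {q : ℕ} (u : Fin q → ℕ) (t : Fin q) : rankOf u t < q := by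
  have : (Finset.univ.filter fun s : Fin q =>
      u s < u t ∧ ∀ s' < s, u s' < u s ∨ u s < u s') ⊂ Finset.univ := by
    rw [Finset.ssubset_univ_iff]
    intro h
    have := Finset.mem_univ t
    rw [← h] at this
    simp at this
  exact (Finset.card_lt_card this).trans_eq (by simp)

theorem rankOf_eq_card {q : ℕ} (u : Fin q → ℕ) (t : Fin q) :
    rankOf u t = ((Finset.univ.image u).filter (· < u t)).card := by
  classical
  rw [rankOf]
  refine Finset.card_bij (fun s _ => u s) ?_ ?_ ?_
  · intro s hs
    simp only [Finset.mem_filter, Finset.mem_univ, true_and] at hs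
    simp [hs.1]
  · intro s hs s' hs' h
    simp only [Finset.mem_filter, Finset.mem_univ, true_and] at hs hs'
    rcases lt_trichotomy s s' with hlt | rfl | hlt
    · have := hs'.2 s hlt; omega
    · rfl
    · have := hs.2 s' hlt; omega
  · intro y hy
    simp only [Finset.mem_filter, Finset.mem_image, Finset.mem_univ, true_and] at hy
    obtain ⟨⟨s, rfl⟩, hlt⟩ := hy
    have hne : (Finset.univ.filter fun s' => u s' = u s).Nonempty := ⟨s, by simp⟩
    have hmem := Finset.min'_mem _ hne
    set s₀ := (Finset.univ.filter fun s' => u s' = u s).min' hne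
    simp only [Finset.mem_filter, Finset.mem_univ, true_and] at hmem
    refine ⟨s₀, ?_, hmem⟩
    simp only [Finset.mem_filter, Finset.mem_univ, true_and, hmem]
    refine ⟨hlt, fun s' hs' => ?_⟩
    by_contra hcon
    have : s₀ ≤ s' := Finset.min'_le _ _ (by simp; omega)
    exact absurd hs' this.not_gt

/-- Every tuple bounded by `m` factors through an increasing tuple bounded by `m + q`, via a map
that depends only on its order type. -/
theorem exists_strictMono_comp_rankOf {q m : ℕ} (u : Fin q → ℕ) (hu : ∀ t, u t < m) :
    ∃ e : Fin q → ℕ, StrictMono e ∧ (∀ i, e i < m + q) ∧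
      ∀ t, e ⟨rankOf u t, rankOf_lt u t⟩ = u t := by
  classical
  set U := Finset.univ.image u with hU
  have hUc : U.card ≤ q := by simpa using Finset.card_image_le (s := Finset.univ) (f := u)
  have hUm : ∀ y ∈ U, y < m := by
    intro y hy
    obtain ⟨t, -, rfl⟩ := Finset.mem_image.1 hy
    exact hu t
  set V := U ∪ Finset.Ico m (m + (q - U.card)) with hV
  have hdisj : Disjoint U (Finset.Ico m (m + (q - U.card))) := by
    rw [Finset.disjoint_left]
    intro y hy hy'
    have := hUm y hy
    have := (Finset.mem_Ico.1 hy').1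
    omega
  have hVc : V.card = q := by
    rw [hV, Finset.card_union_of_disjoint hdisj, Nat.card_Ico]
    omega
  refine ⟨V.orderEmbOfFin hVc, (V.orderEmbOfFin hVc).strictMono, fun i => ?_, fun t => ?_⟩
  · have := Finset.orderEmbOfFin_mem V hVc i
    rcases Finset.mem_union.1 this with h | h
    · have := hUm _ h; omega
    · have := (Finset.mem_Ico.1 h).2; omega
  · have htV : u t ∈ V := Finset.mem_union_left _ (Finset.mem_image_of_mem _ (Finset.mem_univ t))
    obtain ⟨i, hi⟩ : ∃ i, V.orderEmbOfFin hVc i = u t := by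
      have : u t ∈ Set.range (V.orderEmbOfFin hVc) := by
        rw [Finset.range_orderEmbOfFin]; exact htV
      exact this
    have hrank : rankOf u t = i := by
      rw [rankOf_eq_card, ← Fin.card_Iio i, ← Finset.card_map (V.orderEmbOfFin hVc).toEmbedding]
      congr 1
      ext y
      simp only [Finset.mem_filter, Finset.mem_map, Finset.mem_Iio]
      constructor
      · rintro ⟨hy, hlt⟩
        have : y ∈ Set.range (V.orderEmbOfFin hVc) := by
          rw [Finset.range_orderEmbOfFin]; exact Finset.mem_union_left _ hy
        obtain ⟨j, rfl⟩ := this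
        refine ⟨j, ?_, rfl⟩
        rw [← hi] at hlt
        exact (V.orderEmbOfFin hVc).lt_iff_lt.1 hlt
      · rintro ⟨j, hj, rfl⟩
        have hlt : V.orderEmbOfFin hVc j < u t := by
          rw [← hi]; exact (V.orderEmbOfFin hVc).lt_iff_lt.2 hj
        refine ⟨?_, hlt⟩
        have := Finset.orderEmbOfFin_mem V hVc j
        rcases Finset.mem_union.1 this with h | h
        · exact h
        · have h1 := (Finset.mem_Ico.1 h).1
          have h2 := hu t
          have h3 : V.orderEmbOfFin hVc j < u t := hlt
          omega
    have : (⟨rankOf u t, rankOf_lt u t⟩ : Fin q) = i := Fin.ext hrank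
    rw [this, hi]

/-- Order indiscernibles: finitely many properties of `q`-tuples of natural numbers can be made to
depend on the order type of the tuple only, by passing to a large subset `h 0 < h 1 < ⋯`. -/
theorem exists_indiscernible (C : Type) [Finite C] (q m : ℕ) : ∃ N : ℕ,
    ∀ P : C → (Fin q → ℕ) → Prop, ∃ h : ℕ → ℕ,
      (∀ i j, i < j → j < m → h i < h j) ∧ (∀ i < m, h i < N) ∧
      ∀ (c : C) (u v : Fin q → ℕ), (∀ t, u t < m) → (∀ t, v t < m) →
        (∀ s t, u s < u t ↔ v s < v t) → (P c (fun t => h (u t)) ↔ P c (fun t => h (v t))) := by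
  classical
  obtain ⟨N, hN⟩ := exists_ramsey (C × (Fin q → Fin q) → Prop) q (m + q)
  refine ⟨N, fun P => ?_⟩
  obtain ⟨H, hHN, hHc, k, hk⟩ := hN
    (fun T => if hT : T.card = q then fun cw => P cw.1 (fun t => T.orderEmbOfFin hT (cw.2 t))
      else fun _ => False) (Finset.range N) (by simp)
  set h : ℕ → ℕ := fun i => if hi : i < m + q then H.orderEmbOfFin hHc ⟨i, hi⟩ else 0 with hh
  have hmono : ∀ i j, i < j → j < m + q → h i < h j := by
    intro i j hij hj
    simp only [hh, hj, hij.trans hj, dif_pos]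
    exact (H.orderEmbOfFin hHc).strictMono hij
  have hmem : ∀ i < m + q, h i ∈ H := by
    intro i hi
    simp only [hh, hi, dif_pos]
    exact Finset.orderEmbOfFin_mem H hHc _
  refine ⟨h, fun i j hij hj => hmono i j hij (by omega),
    fun i hi => Finset.mem_range.1 (hHN (hmem i (by omega))), ?_⟩
  have key : ∀ c (u : Fin q → ℕ), (∀ t, u t < m) →
      (P c (fun t => h (u t)) ↔ k (c, fun t => ⟨rankOf u t, rankOf_lt u t⟩)) := by
    intro c u hu
    obtain ⟨e, he, hem, heu⟩ := exists_strictMono_comp_rankOf u hu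
    have hhe : StrictMono fun i => h (e i) := fun i j hij => hmono _ _ (he hij) (hem j)
    set T := Finset.univ.image fun i => h (e i) with hT
    have hTH : T ⊆ H := by
      intro y hy
      obtain ⟨i, -, rfl⟩ := Finset.mem_image.1 hy
      exact hmem _ (hem i)
    have hTc : T.card = q := by
      rw [hT, Finset.card_image_of_injective _ hhe.injective]; simp
    have hTe : (fun i => h (e i)) = T.orderEmbOfFin hTc :=
      Finset.orderEmbOfFin_unique hTc
        (fun i => Finset.mem_image_of_mem _ (Finset.mem_univ i)) hhe
    have := congrFun (hk T hTH hTc) (c, fun t => ⟨rankOf u t, rankOf_lt u t⟩)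
    rw [dif_pos hTc] at this
    rw [← this, ← hTe]
    simp only [heu]
  intro c u v hu hv huv
  rw [key c u hu, key c v hv]
  simp only [rankOf_congr huv]

/-! ### Extracting a regular pattern from high grid-rank -/

/-- Repeatedly splitting `2 ^ L` distinct sets by an element yields elements `r a` and sets `C a`
such that `r a` separates `C a` from every later `C b`. -/
theorem exists_splitting_sequence {α : Type*} [Nonempty α] : ∀ (L : ℕ) (F : Finset (Set α)),
    2 ^ L ≤ F.card → ∃ (r : ℕ → α) (C : ℕ → Set α), (∀ a < L, C a ∈ F) ∧
      (∀ a < L, ∃ D ∈ F, r a ∈ D) ∧ ∀ a b, a < b → b < L → (r a ∈ C a ↔ r a ∉ C b) := by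
  classical
  intro L
  induction L with
  | zero => exact fun F _ => ⟨fun _ => Classical.arbitrary α, fun _ => ∅, by simp, by simp, by simp⟩
  | succ L ih =>
    intro F hF
    have hpos : 0 < 2 ^ L := by positivity
    have h1 : 1 < F.card := by rw [pow_succ] at hF; omega
    obtain ⟨D, hD, E, hE, hDE⟩ := Finset.one_lt_card.1 h1
    obtain ⟨r₀, hr₀⟩ : ∃ r₀, ¬ (r₀ ∈ D ↔ r₀ ∈ E) := by
      by_contra! h
      exact hDE (Set.ext h)
    have hcard := Finset.card_filter_add_card_filter_not (s := F) (fun C => r₀ ∈ C)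
    -- `b` records whether the larger half consists of the sets containing `r₀`.
    obtain ⟨b, hb, C₀, hC₀, hC₀b⟩ : ∃ b : Prop, 2 ^ L ≤ (F.filter fun C => r₀ ∈ C ↔ b).card ∧
        ∃ C₀ ∈ F, (r₀ ∈ C₀ ↔ ¬ b) := by
      by_cases h : 2 ^ L ≤ (F.filter fun C => r₀ ∈ C).card
      · refine ⟨True, by simpa using h, ?_⟩
        by_cases hrD : r₀ ∈ D
        · exact ⟨E, hE, by tauto⟩
        · exact ⟨D, hD, by tauto⟩
      · refine ⟨False, by simp only [iff_false]; rw [pow_succ] at hF; omega, ?_⟩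
        by_cases hrD : r₀ ∈ D
        · exact ⟨D, hD, by tauto⟩
        · exact ⟨E, hE, by tauto⟩
    obtain ⟨r, C, hC, hr, hrC⟩ := ih _ hb
    refine ⟨fun a => a.casesOn r₀ r, fun a => a.casesOn C₀ C, ?_, ?_, ?_⟩
    · rintro (_ | a) ha
      · exact hC₀
      · exact (Finset.mem_filter.1 (hC a (by omega))).1
    · rintro (_ | a) ha
      · by_cases hrD : r₀ ∈ D
        · exact ⟨D, hD, hrD⟩
        · exact ⟨E, hE, by show r₀ ∈ E; tauto⟩
      · obtain ⟨D', hD', h⟩ := hr a (by omega)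
        exact ⟨D', (Finset.mem_filter.1 hD').1, h⟩
    · rintro (_ | a) (_ | c) hac hc
      · omega
      · have := (Finset.mem_filter.1 (hC c (by omega))).2
        show r₀ ∈ C₀ ↔ r₀ ∉ C c
        tauto
      · omega
      · exact hrC a c (by omega) (by omega)

theorem exists_splitting_of_cellCols {α β : Type*} [Nonempty α] [Nonempty β] {M : Set (α × β)}
    {I : Set α} {J : Set β} {L e : ℕ} (he : 2 ^ L ≤ e) (h : (e : ℕ∞) ≤ (cellCols M I J).encard) :
    ∃ (r : ℕ → α) (c : ℕ → β), (∀ a < L, r a ∈ I) ∧ (∀ a < L, c a ∈ J) ∧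
      ∀ a b, a < b → b < L → ((r a, c a) ∈ M ↔ (r a, c b) ∉ M) := by
  classical
  obtain ⟨F, hF, hFc⟩ := Set.exists_subset_encard_eq h
  have hfin : F.Finite := Set.finite_of_encard_eq_coe hFc
  have hcard : hfin.toFinset.card = e := by
    have := hfin.encard_eq_coe_toFinset_card
    rw [hFc] at this
    exact_mod_cast this.symm
  obtain ⟨r, C, hC, hr, hrC⟩ := exists_splitting_sequence L hfin.toFinset (by omega)
  have hsub : ∀ D ∈ hfin.toFinset, ∃ b ∈ J, {a | a ∈ I ∧ (a, b) ∈ M} = D :=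
    fun D hD => hF (hfin.mem_toFinset.1 hD)
  have hrI : ∀ a < L, r a ∈ I := by
    intro a ha
    obtain ⟨D, hD, haD⟩ := hr a ha
    obtain ⟨b, -, rfl⟩ := hsub D hD
    exact haD.1
  have hex : ∀ a, ∃ b, a < L → b ∈ J ∧ {a | a ∈ I ∧ (a, b) ∈ M} = C a := by
    intro a
    by_cases ha : a < L
    · obtain ⟨b, hb, h⟩ := hsub _ (hC a ha)
      exact ⟨b, fun _ => ⟨hb, h⟩⟩
    · exact ⟨Classical.arbitrary β, fun h => absurd h ha⟩
  choose c hc using hex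
  refine ⟨r, c, hrI, fun a ha => (hc a ha).1, fun a b hab hb => ?_⟩
  have := hrC a b hab hb
  rw [← (hc a (hab.trans hb)).2, ← (hc b hb).2] at this
  have hI := hrI a (hab.trans hb)
  simpa [hI] using this

/-- A regular `m × m` pattern in the matrix of `M`. The rows `x g a` are ordered by `g` first and
the columns `y g a` by `a` first; for fixed `g`, the row `x g a` has the value `v` at `y g a` and
the opposite value at each `y g b` with `a < b`. -/
def HasPattern {α β : Type*} [LinearOrder α] [LinearOrder β] (M : Set (α × β)) (m : ℕ)
    (v : Prop) : Prop :=
  ∃ (x : ℕ → ℕ → α) (y : ℕ → ℕ → β),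
    (∀ g a g' a', g < g' → g' < m → a < m → a' < m → x g a < x g' a') ∧
    (∀ g a g' a', a < a' → a' < m → g < m → g' < m → y g a < y g' a') ∧
    (∀ g a, g < m → a < m → ((x g a, y g a) ∈ M ↔ v)) ∧
    ∀ g a b, g < m → a < b → b < m → ((x g a, y g b) ∈ M ↔ ¬ v)

/-- High grid-rank provides rows `r i j a` in the part `i` and columns `c i j a` in the part `j`
such that, within the cell `(i, j)`, the row with index `a` separates the column with index `a`
from all later ones. -/
theorem exists_splitting_of_hasGridRank {α β : Type*} [LinearOrder α] [LinearOrder β]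
    {M : Set (α × β)} {L e : ℕ} (he : 2 ^ L ≤ e) (h : HasGridRank M e) :
    ∃ (r : ℕ → ℕ → ℕ → α) (c : ℕ → ℕ → ℕ → β),
      (∀ i j a i' j' a', i < i' → i' < L → j < L → j' < L → a < L → a' < L →
        r i j a < r i' j' a') ∧
      (∀ i j a i' j' a', j < j' → j' < L → i < L → i' < L → a < L → a' < L →
        c i j a < c i' j' a') ∧
      ∀ i j a b, i < L → j < L → a < b → b < L →
        ((r i j a, c i j a) ∈ M ↔ (r i j a, c i j b) ∉ M) := by
  obtain ⟨I, J, hI, hJ, hcell⟩ := h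
  have hLe : L ≤ e := (Nat.lt_two_pow_self).le.trans he
  have he0 : 0 < e := lt_of_lt_of_le (by positivity) he
  have : Nonempty α := (hI.2.1 ⟨0, he0⟩).to_type
  have : Nonempty β := (hJ.2.1 ⟨0, he0⟩).to_type
  have hex : ∀ i j : ℕ, ∃ (r : ℕ → α) (c : ℕ → β), ∀ (hi : i < e) (hj : j < e),
      (∀ a < L, r a ∈ I ⟨i, hi⟩) ∧ (∀ a < L, c a ∈ J ⟨j, hj⟩) ∧
      ∀ a b, a < b → b < L → ((r a, c a) ∈ M ↔ (r a, c b) ∉ M) := by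
    intro i j
    by_cases hij : i < e ∧ j < e
    · obtain ⟨r, c, h⟩ := exists_splitting_of_cellCols he (hcell ⟨i, hij.1⟩ ⟨j, hij.2⟩).2
      exact ⟨r, c, fun _ _ => h⟩
    · exact ⟨fun _ => Classical.arbitrary α, fun _ => Classical.arbitrary β,
        fun hi hj => absurd ⟨hi, hj⟩ hij⟩
  choose r c hrc using hex
  refine ⟨r, c, ?_, ?_, ?_⟩
  · intro i j a i' j' a' hii hi' hj hj' ha ha'
    exact hI.2.2 ⟨i, by omega⟩ ⟨i', by omega⟩ hii _ ((hrc i j (by omega) (by omega)).1 a ha) _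
      ((hrc i' j' (by omega) (by omega)).1 a' ha')
  · intro i j a i' j' a' hjj hj' hi hi' ha ha'
    exact hJ.2.2 ⟨j, by omega⟩ ⟨j', by omega⟩ hjj _ ((hrc i j (by omega) (by omega)).2.1 a ha) _
      ((hrc i' j' (by omega) (by omega)).2.1 a' ha')
  · intro i j a b hi hj hab hb
    exact (hrc i j (by omega) (by omega)).2.2 a b hab hb

/-- High grid-rank yields a large regular pattern, up to exchanging rows and columns.

Rows `r i j a` and columns `c i j a` are chosen in each cell `(i, j)` so that `r i j a` separates
`c i j a` from `c i j b` for `a < b`, and made order indiscernible. Move the cell of the column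
away from `(i, j)`, to `(i, l)` and then to `(k, l)`. If one of the moves changes an entry, then
the rows or columns with that choice of `a` and `b` form a pattern; otherwise `r i j a` separates
`c k l a` from `c k l b` even for unrelated cells, and the index `a` gives the pattern. -/
theorem exists_hasPattern (m : ℕ) : ∃ N : ℕ, ∀ {α β : Type} [LinearOrder α] [LinearOrder β]
    (M : Set (α × β)) (e : ℕ), N ≤ e → HasGridRank M e →
      ∃ v, HasPattern M m v ∨ HasPattern {p : β × α | (p.2, p.1) ∈ M} m v := by
  -- The index range is cut into three blocks of length `B`, for `i`, `j` and `a` respectively.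
  set B := m + 2 with hB
  obtain ⟨L, hL⟩ := exists_indiscernible Unit 6 (3 * B)
  refine ⟨2 ^ L, fun {α β} _ _ M e he hM => ?_⟩
  obtain ⟨r, c, hr, hc, hrc⟩ := exists_splitting_of_hasGridRank he hM
  obtain ⟨h, hmono, hlt, hind⟩ := hL
    (fun _ u => (r (u 0) (u 1) (u 2), c (u 3) (u 4) (u 5)) ∈ M)
  set R : ℕ → ℕ → ℕ → α := fun i j a => r (h i) (h (B + j)) (h (2 * B + a)) with hR
  set C : ℕ → ℕ → ℕ → β := fun i j a => c (h i) (h (B + j)) (h (2 * B + a)) with hC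
  have hRlt : ∀ i j a i' j' a', i < i' → i' < B → j < B → j' < B → a < B → a' < B →
      R i j a < R i' j' a' := by
    intro i j a i' j' a' hii hi' hj hj' ha ha'
    exact hr _ _ _ _ _ _ (hmono _ _ hii (by omega)) (hlt _ (by omega)) (hlt _ (by omega))
      (hlt _ (by omega)) (hlt _ (by omega)) (hlt _ (by omega))
  have hClt : ∀ i j a i' j' a', j < j' → j' < B → i < B → i' < B → a < B → a' < B →
      C i j a < C i' j' a' := by
    intro i j a i' j' a' hjj hj' hi hi' ha ha'
    exact hc _ _ _ _ _ _ (hmono _ _ (by omega) (by omega)) (hlt _ (by omega)) (hlt _ (by omega))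
      (hlt _ (by omega)) (hlt _ (by omega)) (hlt _ (by omega))
  have hsep : ∀ i j a b, i < B → j < B → a < b → b < B →
      ((R i j a, C i j a) ∈ M ↔ (R i j a, C i j b) ∉ M) := by
    intro i j a b hi hj hab hb
    exact hrc _ _ _ _ (hlt _ (by omega)) (hlt _ (by omega)) (hmono _ _ (by omega) (by omega))
      (hlt _ (by omega))
  have hinv : ∀ i j a k l b i' j' a' k' l' b', i < B → j < B → a < B → k < B → l < B → b < B →
      i' < B → j' < B → a' < B → k' < B → l' < B → b' < B →
      ((i < k ↔ i' < k') ∧ (k < i ↔ k' < i')) → ((j < l ↔ j' < l') ∧ (l < j ↔ l' < j')) →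
      ((a < b ↔ a' < b') ∧ (b < a ↔ b' < a')) →
      ((R i j a, C k l b) ∈ M ↔ (R i' j' a', C k' l' b') ∈ M) := by
    intro i j a k l b i' j' a' k' l' b' _ _ _ _ _ _ _ _ _ _ _ _ hik hjl hab
    have := hind () ![i, B + j, 2 * B + a, k, B + l, 2 * B + b]
      ![i', B + j', 2 * B + a', k', B + l', 2 * B + b']
      (by simp [Fin.forall_fin_succ]; omega) (by simp [Fin.forall_fin_succ]; omega)
      (by simp [Fin.forall_fin_succ]; omega)
    exact this
  clear_value R C
  clear hind hmono hlt hrc hr hc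
  by_contra hcon
  push Not at hcon
  -- Moving the column from the cell `(i, j)` to `(i, l)` with `j < l`.
  have move₁ : ∀ i j a l b, i < B → j < l → l < B → a < B → b < B →
      ((R i j a, C i l b) ∈ M ↔ (R i j a, C i j b) ∈ M) := by
    intro i j a l b hi hjl hl ha hb
    by_contra hne
    refine (hcon ((R i j a, C i j b) ∈ M)).1 ⟨fun g s => R g s a, fun g s => C g s b,
      ?_, ?_, ?_, ?_⟩
    · intros; apply hRlt <;> omega
    · intros; apply hClt <;> omega
    · intros; apply hinv <;> omega
    · intro g s t hg hst ht
      have : (R g s a, C g t b) ∈ M ↔ (R i j a, C i l b) ∈ M := by apply hinv <;> omega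
      tauto
  -- Moving the column from the cell `(i, l)` to `(k, l)` with `k < i`.
  have move₂ : ∀ i j a k l b, k < i → i < B → j < l → l < B → a < B → b < B →
      ((R i j a, C k l b) ∈ M ↔ (R i j a, C i l b) ∈ M) := by
    intro i j a k l b hki hi hjl hl ha hb
    by_contra hne
    refine (hcon ((R i j a, C i l b) ∈ M)).2 ⟨fun g s => C s (g + 1) b, fun _ s => R s 0 a,
      ?_, ?_, ?_, ?_⟩
    · intros; apply hClt <;> omega
    · intros; apply hRlt <;> omega
    · intro g s hg hs
      show (R s 0 a, C s (g + 1) b) ∈ M ↔ _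
      apply hinv <;> omega
    · intro g s t hg hst ht
      show (R t 0 a, C s (g + 1) b) ∈ M ↔ _
      have : (R t 0 a, C s (g + 1) b) ∈ M ↔ (R i j a, C k l b) ∈ M := by apply hinv <;> omega
      tauto
  have hsep' : (R 1 0 0, C 0 1 0) ∈ M ↔ (R 1 0 0, C 0 1 1) ∉ M := by
    rw [move₂ 1 0 0 0 1 0, move₂ 1 0 0 0 1 1, move₁ 1 0 0 1 0, move₁ 1 0 0 1 1] <;> try omega
    apply hsep <;> omega
  refine (hcon ((R 1 0 0, C 0 1 0) ∈ M)).1 ⟨fun g s => R (g + 1) 0 s, fun _ s => C 0 (s + 1) s,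
    ?_, ?_, ?_, ?_⟩
  · intros; apply hRlt <;> omega
  · intros; apply hClt <;> omega
  · intros; apply hinv <;> omega
  · intro g s t hg hst ht
    have : (R (g + 1) 0 s, C 0 (t + 1) t) ∈ M ↔ (R 1 0 0, C 0 1 1) ∈ M := by apply hinv <;> omega
    tauto

/-! ### A sufficient condition for high grid-rank -/

/-- The number with base-`m` digits `G`, `B`, `a`. -/
def digits3 (m G B a : ℕ) : ℕ := (G * m + B) * m + a

/-- Exchange the two leading digits of a three-digit number in base `m`. -/
def swapDigits (m n : ℕ) : ℕ := digits3 m (n / m % m) (n / m / m) (n % m)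

theorem digits3_div {m G B a : ℕ} (ha : a < m) : digits3 m G B a / m = G * m + B := by
  rw [digits3, mul_comm, Nat.mul_add_div (by omega), Nat.div_eq_of_lt ha, add_zero]

theorem digits3_div_div {m G B a : ℕ} (hB : B < m) (ha : a < m) :
    digits3 m G B a / m / m = G := by
  rw [digits3_div ha, mul_comm, Nat.mul_add_div (by omega), Nat.div_eq_of_lt hB, add_zero]

theorem digits3_mod {m G B a : ℕ} (ha : a < m) : digits3 m G B a % m = a :=
  Nat.mul_add_mod_of_lt ha

theorem swapDigits_digits3 {m G B a : ℕ} (hB : B < m) (ha : a < m) :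
    swapDigits m (digits3 m G B a) = digits3 m B G a := by
  rw [swapDigits, digits3_div_div hB ha, digits3_div ha, Nat.mul_add_mod_of_lt hB,
    digits3_mod ha]

theorem digits3_lt {m G B a : ℕ} (hG : G < m) (hB : B < m) (ha : a < m) :
    digits3 m G B a < m * m * m := by
  have h1 : G * m + B < m * m := by nlinarith
  rw [digits3]
  nlinarith

theorem exists_eq_digits3 {m n : ℕ} (hn : n < m * m * m) :
    ∃ G < m, ∃ B < m, ∃ a < m, n = digits3 m G B a := by
  have hm : 0 < m := Nat.pos_of_ne_zero (by rintro rfl; simp at hn)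
  refine ⟨n / m / m, ?_, n / m % m, Nat.mod_lt _ hm, n % m, Nat.mod_lt _ hm, ?_⟩
  · rw [Nat.div_div_eq_div_mul]
    exact Nat.div_lt_of_lt_mul hn
  · rw [digits3, Nat.div_add_mod', Nat.div_add_mod']

theorem swapDigits_lt {m n : ℕ} (hn : n < m * m * m) : swapDigits m n < m * m * m := by
  obtain ⟨G, hG, B, hB, a, ha, rfl⟩ := exists_eq_digits3 hn
  rw [swapDigits_digits3 hB ha]
  exact digits3_lt hB hG ha

theorem swapDigits_swapDigits {m n : ℕ} (hn : n < m * m * m) :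
    swapDigits m (swapDigits m n) = n := by
  obtain ⟨G, hG, B, hB, a, ha, rfl⟩ := exists_eq_digits3 hn
  rw [swapDigits_digits3 hB ha, swapDigits_digits3 hG ha]

theorem swapDigits_ne {m n n' : ℕ} (hn : n < m * m * m) (hn' : n' < m * m * m) (h : n ≠ n') :
    swapDigits m n ≠ swapDigits m n' := fun heq =>
  h (by rw [← swapDigits_swapDigits hn, heq, swapDigits_swapDigits hn'])

theorem isOrderedPartition_leadingDigit (m : ℕ) : IsOrderedPartition
    (fun G : Fin m => {n : Fin (m * m * m) | (n : ℕ) / m / m = G}) := by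
  refine ⟨?_, fun G => ?_, ?_⟩
  · refine Set.eq_univ_of_forall fun n => Set.mem_iUnion.2 ?_
    obtain ⟨G, hG, B, hB, a, ha, h⟩ := exists_eq_digits3 n.2
    exact ⟨⟨G, hG⟩, by simp [h, digits3_div_div hB ha]⟩
  · have hm : 0 < m := G.pos
    exact ⟨⟨digits3 m G 0 0, digits3_lt G.2 hm hm⟩, digits3_div_div hm hm⟩
  · intro G G' hGG n hn n' hn'
    simp only [Set.mem_ofPred_eq] at hn hn'
    by_contra hcon
    have h1 : (n' : ℕ) ≤ n := not_lt.1 hcon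
    have h2 : (n' : ℕ) / m / m ≤ n / m / m := Nat.div_le_div_right (Nat.div_le_div_right h1)
    have h3 : (G : ℕ) < G' := hGG
    omega

/-- The graph of `swapDigits m` is a permutation that meets each of the `m × m` cells in an
increasing sequence of `m` points. A matrix in which every row takes the value `v` at its own point
and the opposite value at the points later in both coordinates has grid-rank at least `m`. -/
theorem hasGridRank_of_triangular {m : ℕ} {v : Prop} (Q : ℕ → ℕ → Prop)
    (h₁ : ∀ n < m * m * m, (Q n (swapDigits m n) ↔ v))
    (h₂ : ∀ n n', n < n' → n' < m * m * m → swapDigits m n < swapDigits m n' →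
      (Q n (swapDigits m n') ↔ ¬ v)) :
    HasGridRank {p : Fin (m * m * m) × Fin (m * m * m) | Q p.1 p.2} m := by
  refine ⟨_, _, isOrderedPartition_leadingDigit m, isOrderedPartition_leadingDigit m,
    fun G B => ?_⟩
  let row : Fin m → Fin (m * m * m) := fun a => ⟨digits3 m G B a, digits3_lt G.2 B.2 a.2⟩
  let col : Fin m → Fin (m * m * m) := fun a => ⟨digits3 m B G a, digits3_lt B.2 G.2 a.2⟩
  have hdiag : ∀ a, Q (row a) (col a) ↔ v := by
    intro a
    have := h₁ (row a) (row a).2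
    rwa [swapDigits_digits3 B.2 a.2] at this
  have hupper : ∀ a b, a < b → (Q (row a) (col b) ↔ ¬ v) := by
    intro a b hab
    have hab' : (a : ℕ) < b := hab
    have := h₂ (row a) (row b) (by simp only [row, digits3]; omega) (row b).2
      (by simp only [row]; rw [swapDigits_digits3 B.2 a.2, swapDigits_digits3 B.2 b.2]
          simp only [digits3]; omega)
    rwa [swapDigits_digits3 B.2 b.2] at this
  have hrow : ∀ a, (row a : ℕ) / m / m = G := fun a => digits3_div_div B.2 a.2
  have hcol : ∀ a, (col a : ℕ) / m / m = B := fun a => digits3_div_div G.2 a.2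
  -- `m` distinct values of an injective family give the required cardinality.
  have hcard : ∀ {γ : Type} (f : Fin m → γ) (s : Set γ), (∀ a b, a < b → f a ≠ f b) →
      (∀ a, f a ∈ s) → (m : ℕ∞) ≤ s.encard := by
    intro γ f s hf hs
    have hinj : Function.Injective f := by
      intro a b hab
      rcases lt_trichotomy a b with h | h | h
      · exact absurd hab (hf a b h)
      · exact h
      · exact absurd hab.symm (hf b a h)
    have h1 : (Set.range f).encard = m := by
      rw [← Set.image_univ, hinj.encard_image, Set.encard_univ]
      simp
    rw [← h1]
    exact Set.encard_le_encard (Set.range_subset_iff.2 hs)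
  refine ⟨hcard (fun a => {b : Fin (m * m * m) | (b : ℕ) / m / m = B ∧ Q (row a) b}) _ ?_ ?_,
    hcard (fun a => {b : Fin (m * m * m) | (b : ℕ) / m / m = G ∧ Q b (col a)}) _ ?_ ?_⟩
  · intro a b hab heq
    have := Set.ext_iff.1 heq (col b)
    simp only [Set.mem_ofPred_eq, hcol, true_and, hdiag, hupper a b hab] at this
    tauto
  · exact fun a => ⟨row a, hrow a, rfl⟩
  · intro a b hab heq
    have := Set.ext_iff.1 heq (row a)
    simp only [Set.mem_ofPred_eq, hrow, true_and, hdiag, hupper a b hab] at this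
    tauto
  · exact fun a => ⟨col a, hcol a, rfl⟩

/-! ### Projecting a ternary relation -/

/-- Two points of the grid `n × n` that differ in both coordinates. -/
def IsGeneric (n g a h b : ℕ) : Prop := g < n ∧ a < n ∧ h < n ∧ b < n ∧ g ≠ h ∧ a ≠ b

/-- On generic pairs of grid points, `z` is constant or strictly monotone in the first
coordinate. -/
def FollowsFst {ζ : Type*} [LinearOrder ζ] (n : ℕ) (z : ℕ → ℕ → ζ) : Prop :=
  (∀ g a h b, IsGeneric n g a h b → ¬ z g a < z h b) ∨
  (∀ g a h b, IsGeneric n g a h b → g < h → z g a < z h b) ∨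
  (∀ g a h b, IsGeneric n g a h b → g < h → z h b < z g a)

/-- On generic pairs of grid points, `z` is strictly monotone in the second coordinate. -/
def FollowsSnd {ζ : Type*} [LinearOrder ζ] (n : ℕ) (z : ℕ → ℕ → ζ) : Prop :=
  (∀ g a h b, IsGeneric n g a h b → a < b → z g a < z h b) ∨
  (∀ g a h b, IsGeneric n g a h b → a < b → z h b < z g a)

/-- If the order of `z` at two generic points depends only on their relative position, then one of
the two coordinates governs `z`. -/
theorem followsFst_or_followsSnd {ζ : Type*} [LinearOrder ζ] {n : ℕ} (hn : 3 ≤ n) (z : ℕ → ℕ → ζ)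
    (hz : ∀ g a h b g' a' h' b', IsGeneric n g a h b → IsGeneric n g' a' h' b' →
      (g < h ↔ g' < h') → (a < b ↔ a' < b') → (z g a < z h b ↔ z g' a' < z h' b')) :
    FollowsFst n z ∨ FollowsSnd n z := by
  have hA₁ : ∀ g a h b, IsGeneric n g a h b → g < h → a < b →
      (z g a < z h b ↔ z 0 0 < z 1 1) := by
    intro g a h b hG h1 h2
    apply hz <;> simp only [IsGeneric] at * <;> omega
  have hA₂ : ∀ g a h b, IsGeneric n g a h b → h < g → b < a →
      (z g a < z h b ↔ z 1 1 < z 0 0) := by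
    intro g a h b hG h1 h2
    apply hz <;> simp only [IsGeneric] at * <;> omega
  have hB₁ : ∀ g a h b, IsGeneric n g a h b → g < h → b < a →
      (z g a < z h b ↔ z 0 1 < z 1 0) := by
    intro g a h b hG h1 h2
    apply hz <;> simp only [IsGeneric] at * <;> omega
  have hB₂ : ∀ g a h b, IsGeneric n g a h b → h < g → a < b →
      (z g a < z h b ↔ z 1 0 < z 0 1) := by
    intro g a h b hG h1 h2
    apply hz <;> simp only [IsGeneric] at * <;> omega
  have hswap : ∀ g a h b, IsGeneric n g a h b → IsGeneric n h b g a := by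
    intro g a h b hG
    simp only [IsGeneric] at *; omega
  by_cases A₁ : z 0 0 < z 1 1
  · by_cases B₁ : z 0 1 < z 1 0
    · refine Or.inl (Or.inr (Or.inl fun g a h b hG hgh => ?_))
      rcases lt_or_gt_of_ne hG.2.2.2.2.2 with hab | hab
      · exact (hA₁ _ _ _ _ hG hgh hab).2 A₁
      · exact (hB₁ _ _ _ _ hG hgh hab).2 B₁
    · by_cases B₂ : z 1 0 < z 0 1
      · refine Or.inr (Or.inl fun g a h b hG hab => ?_)
        rcases lt_or_gt_of_ne hG.2.2.2.2.1 with hgh | hgh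
        · exact (hA₁ _ _ _ _ hG hgh hab).2 A₁
        · exact (hB₂ _ _ _ _ hG hgh hab).2 B₂
      · have e₁ := (hB₁ 0 2 2 1 (by simp only [IsGeneric]; omega) (by omega) (by omega)).not.2 B₁
        have e₂ := (hB₂ 1 0 0 2 (by simp only [IsGeneric]; omega) (by omega) (by omega)).not.2 B₂
        have e₃ := (hA₁ 1 0 2 1 (by simp only [IsGeneric]; omega) (by omega) (by omega)).2 A₁
        exact absurd (e₃.trans_le ((not_lt.1 e₁).trans (not_lt.1 e₂))) (lt_irrefl _)
  · by_cases A₂ : z 1 1 < z 0 0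
    · by_cases B₁ : z 0 1 < z 1 0
      · refine Or.inr (Or.inr fun g a h b hG hab => ?_)
        rcases lt_or_gt_of_ne hG.2.2.2.2.1 with hgh | hgh
        · exact (hA₂ _ _ _ _ (hswap _ _ _ _ hG) hgh hab).2 A₂
        · exact (hB₁ _ _ _ _ (hswap _ _ _ _ hG) hgh hab).2 B₁
      · by_cases B₂ : z 1 0 < z 0 1
        · refine Or.inl (Or.inr (Or.inr fun g a h b hG hgh => ?_))
          rcases lt_or_gt_of_ne hG.2.2.2.2.2 with hab | hab
          · exact (hA₂ _ _ _ _ (hswap _ _ _ _ hG) hgh hab).2 A₂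
          · exact (hB₂ _ _ _ _ (hswap _ _ _ _ hG) hgh hab).2 B₂
        · have e₁ := (hB₁ 0 2 1 0 (by simp only [IsGeneric]; omega) (by omega) (by omega)).not.2 B₁
          have e₂ := (hB₂ 2 1 0 2 (by simp only [IsGeneric]; omega) (by omega) (by omega)).not.2 B₂
          have e₃ := (hA₂ 2 1 1 0 (by simp only [IsGeneric]; omega) (by omega) (by omega)).2 A₂
          exact absurd (e₃.trans_le ((not_lt.1 e₁).trans (not_lt.1 e₂))) (lt_irrefl _)
    · have e : ∀ g a h b, IsGeneric n g a h b → g < h → a < b → z g a = z h b := by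
        intro g a h b hG h1 h2
        exact le_antisymm (not_lt.1 ((hA₂ _ _ _ _ (hswap _ _ _ _ hG) h1 h2).not.2 A₂))
          (not_lt.1 ((hA₁ _ _ _ _ hG h1 h2).not.2 A₁))
      have e' : z 0 1 = z 1 0 :=
        (e 0 1 2 2 (by simp only [IsGeneric]; omega) (by omega) (by omega)).trans
          (e 1 0 2 2 (by simp only [IsGeneric]; omega) (by omega) (by omega)).symm
      refine Or.inl (Or.inl fun g a h b hG => ?_)
      rcases lt_or_gt_of_ne hG.2.2.2.2.1 with hgh | hgh <;>
        rcases lt_or_gt_of_ne hG.2.2.2.2.2 with hab | hab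
      · exact (hA₁ _ _ _ _ hG hgh hab).not.2 A₁
      · exact (hB₁ _ _ _ _ hG hgh hab).not.2 (by rw [e']; exact lt_irrefl _)
      · exact (hB₂ _ _ _ _ hG hgh hab).not.2 (by rw [e']; exact lt_irrefl _)
      · exact (hA₂ _ _ _ _ hG hgh hab).not.2 A₂

/-- A sequence that is strictly increasing, constant or strictly decreasing. -/
def IsStrictOrConst {n : ℕ} {γ : Type*} [Preorder γ] (f : Fin n → γ) : Prop :=
  StrictMono f ∨ (∀ a b, f a = f b) ∨ StrictAnti f

theorem FollowsFst.isStrictOrConst {ζ : Type*} [LinearOrder ζ] {m : ℕ} {z : ℕ → ℕ → ζ}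
    (hz : FollowsFst (m * m * m) z) :
    IsStrictOrConst fun n : Fin (m * m * m) => z n (swapDigits m n) := by
  have hG : ∀ n n' : Fin (m * m * m), n ≠ n' →
      IsGeneric (m * m * m) n (swapDigits m n) n' (swapDigits m n') := fun n n' h =>
    ⟨n.2, swapDigits_lt n.2, n'.2, swapDigits_lt n'.2, Fin.val_ne_of_ne h,
      swapDigits_ne n.2 n'.2 (Fin.val_ne_of_ne h)⟩
  rcases hz with hz | hz | hz
  · refine Or.inr (Or.inl fun n n' => ?_)
    by_cases h : n = n'
    · rw [h]
    · exact le_antisymm (not_lt.1 (hz _ _ _ _ (hG _ _ (Ne.symm h))))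
        (not_lt.1 (hz _ _ _ _ (hG _ _ h)))
  · exact Or.inl fun n n' h => hz _ _ _ _ (hG _ _ h.ne) h
  · exact Or.inr (Or.inr fun n n' h => hz _ _ _ _ (hG _ _ h.ne) h)

theorem FollowsSnd.isStrictOrConst {ζ : Type*} [LinearOrder ζ] {m : ℕ} {z : ℕ → ℕ → ζ}
    (hz : FollowsSnd (m * m * m) z) :
    IsStrictOrConst fun n : Fin (m * m * m) => z (swapDigits m n) n := by
  have hG : ∀ n n' : Fin (m * m * m), n ≠ n' →
      IsGeneric (m * m * m) (swapDigits m n) n (swapDigits m n') n' := fun n n' h =>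
    ⟨swapDigits_lt n.2, n.2, swapDigits_lt n'.2, n'.2,
      swapDigits_ne n.2 n'.2 (Fin.val_ne_of_ne h), Fin.val_ne_of_ne h⟩
  rcases hz with hz | hz
  · exact Or.inl fun n n' h => hz _ _ _ _ (hG _ _ h.ne) h
  · exact Or.inr (Or.inr fun n n' h => hz _ _ _ _ (hG _ _ h.ne) h)

/-- If the projection of a ternary relation to its first two arguments has a large pattern, then
the relation has high grid-rank after attaching the third argument to the rows or to the columns.

The third argument `z` is a witness for an entry next to the diagonal of the pattern. Once
everything is order indiscernible, `z` follows one of the two grid coordinates on generic pairs of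
points, and is attached to the side that is ordered by that coordinate. -/
theorem hasGridRank_of_hasPattern {m : ℕ} (hm : 2 ≤ m) : ∃ N : ℕ, ∀ {X Y Z : Type}
    [LinearOrder X] [LinearOrder Y] [LinearOrder Z] (R : X → Y → Z → Prop) (v : Prop),
    HasPattern {p : X × Y | ∃ z, R p.1 p.2 z} N v →
    ∃ (x : Fin (m * m * m) → X) (y : Fin (m * m * m) → Y) (z : Fin (m * m * m) → Z),
      StrictMono x ∧ StrictMono y ∧ IsStrictOrConst z ∧
      (HasGridRank {p : Fin (m * m * m) × Fin (m * m * m) | R (x p.1) (y p.2) (z p.1)} m ∨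
        HasGridRank {p : Fin (m * m * m) × Fin (m * m * m) | R (x p.1) (y p.2) (z p.2)} m) := by
  set K := m * m * m with hK
  have hK3 : 3 ≤ K := by
    have : 2 * 2 * 2 ≤ m * m * m := Nat.mul_le_mul (Nat.mul_le_mul hm hm) hm
    omega
  -- Indices below `K` are used for the first grid coordinate, and `K + a` with `a < 3 * K` for the
  -- second one.
  obtain ⟨N, hN⟩ := exists_indiscernible (Fin 3) 6 (4 * K)
  refine ⟨N + 2, fun {X Y Z} _ _ _ R v hpat => ?_⟩
  classical
  obtain ⟨x₀, y₀, hx₀, hy₀, hdiag, hupper⟩ := hpat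
  have hZ : Nonempty Z := by
    by_cases hv : v
    · obtain ⟨z, -⟩ := (hdiag 0 0 (by omega) (by omega)).2 hv
      exact ⟨z⟩
    · obtain ⟨z, -⟩ := (hupper 0 0 1 (by omega) (by omega) (by omega)).2 hv
      exact ⟨z⟩
  have hwit : ∀ g a b, ∃ z, (∃ z', R (x₀ g a) (y₀ g b) z') → R (x₀ g a) (y₀ g b) z := by
    intro g a b
    by_cases h : ∃ z', R (x₀ g a) (y₀ g b) z'
    · exact ⟨h.choose, fun _ => h.choose_spec⟩
    · exact ⟨Classical.arbitrary Z, fun h' => absurd h' h⟩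
  choose z₀ hz₀ using hwit
  obtain ⟨h, hmono, hlt, hind⟩ := hN ![
    fun u => z₀ (u 0) (u 1) (u 2) < z₀ (u 3) (u 4) (u 5),
    fun u => R (x₀ (u 0) (u 1)) (y₀ (u 3) (u 4)) (z₀ (u 0) (u 1) (u 2)),
    fun u => R (x₀ (u 0) (u 1)) (y₀ (u 3) (u 4)) (z₀ (u 3) (u 2) (u 5))]
  set X' : ℕ → ℕ → X := fun g a => x₀ (h g) (h (K + a)) with hX'
  set Y' : ℕ → ℕ → Y := fun g a => y₀ (h g) (h (K + a)) with hY'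
  set Z' : ℕ → ℕ → ℕ → Z := fun g a b => z₀ (h g) (h (K + a)) (h (K + b)) with hZ'
  have hX : ∀ g a g' a', g < g' → g' < K → a < 3 * K → a' < 3 * K → X' g a < X' g' a' := by
    intro g a g' a' hgg hg ha ha'
    have h1 := hlt g' (by omega)
    have h2 := hlt (K + a) (by omega)
    have h3 := hlt (K + a') (by omega)
    exact hx₀ _ _ _ _ (hmono _ _ hgg (by omega)) (by omega) (by omega) (by omega)
  have hY : ∀ g a g' a', a < a' → a' < 3 * K → g < K → g' < K → Y' g a < Y' g' a' := by
    intro g a g' a' haa ha hg hg'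
    have h1 := hlt g (by omega)
    have h2 := hlt g' (by omega)
    have h3 := hlt (K + a') (by omega)
    exact hy₀ _ _ _ _ (hmono _ _ (by omega) (by omega)) (by omega) (by omega) (by omega)
  have hS₁ : ∀ g a, g < K → a < 3 * K → ((∃ z, R (X' g a) (Y' g a) z) ↔ v) := by
    intro g a hg ha
    have h1 := hlt g (by omega)
    have h2 := hlt (K + a) (by omega)
    exact hdiag _ _ (by omega) (by omega)
  have hS₂ : ∀ g a b, g < K → a < b → b < 3 * K → ((∃ z, R (X' g a) (Y' g b) z) ↔ ¬ v) := by
    intro g a b hg hab hb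
    have h1 := hlt g (by omega)
    have h2 := hlt (K + b) (by omega)
    exact hupper _ _ _ (by omega) (hmono _ _ (by omega) (by omega)) (by omega)
  have hZw : ∀ g a b, (∃ z, R (X' g a) (Y' g b) z) → R (X' g a) (Y' g b) (Z' g a b) :=
    fun g a b => hz₀ _ _ _
  have hZlt : ∀ g a a₁ h b b₁ g' a' a₁' h' b' b₁', g < K → h < K → a < 3 * K → a₁ < 3 * K →
      b < 3 * K → b₁ < 3 * K → g' < K → h' < K → a' < 3 * K → a₁' < 3 * K → b' < 3 * K →
      b₁' < 3 * K → (g < h ↔ g' < h') → (h < g ↔ h' < g') →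
      ((a < a₁ ∧ a₁ < b ∧ b < b₁ ∧ a' < a₁' ∧ a₁' < b' ∧ b' < b₁') ∨
       (a = a₁ ∧ a₁ < b ∧ b = b₁ ∧ a' = a₁' ∧ a₁' < b' ∧ b' = b₁') ∨
       (b < b₁ ∧ b₁ < a ∧ a < a₁ ∧ b' < b₁' ∧ b₁' < a' ∧ a' < a₁') ∨
       (b = b₁ ∧ b₁ < a ∧ a = a₁ ∧ b' = b₁' ∧ b₁' < a' ∧ a' = a₁')) →
      (Z' g a a₁ < Z' h b b₁ ↔ Z' g' a' a₁' < Z' h' b' b₁') := by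
    intro g a a₁ h b b₁ g' a' a₁' h' b' b₁' _ _ _ _ _ _ _ _ _ _ _ _ h1 h2 h3
    exact hind 0 ![g, K + a, K + a₁, h, K + b, K + b₁] ![g', K + a', K + a₁', h', K + b', K + b₁']
      (by simp [Fin.forall_fin_succ]; omega) (by simp [Fin.forall_fin_succ]; omega)
      (by simp [Fin.forall_fin_succ]; omega)
  have hRrow : ∀ g a a₁ h b g' a' a₁' h' b', g < h → h < K → a ≤ a₁ → a₁ < b → b < 3 * K →
      g' < h' → h' < K → a' ≤ a₁' → a₁' < b' → b' < 3 * K → (a < a₁ ↔ a' < a₁') →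
      (R (X' g a) (Y' h b) (Z' g a a₁) ↔ R (X' g' a') (Y' h' b') (Z' g' a' a₁')) := by
    intro g a a₁ h b g' a' a₁' h' b' _ _ _ _ _ _ _ _ _ _ _
    exact hind 1 ![g, K + a, K + a₁, h, K + b, g] ![g', K + a', K + a₁', h', K + b', g']
      (by simp [Fin.forall_fin_succ]; omega) (by simp [Fin.forall_fin_succ]; omega)
      (by simp [Fin.forall_fin_succ]; omega)
  have hRcol : ∀ g a h b b₁ g' a' h' b' b₁', g < h → h < K → a < b → b ≤ b₁ → b₁ < 3 * K →
      g' < h' → h' < K → a' < b' → b' ≤ b₁' → b₁' < 3 * K → (b < b₁ ↔ b' < b₁') →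
      (R (X' g a) (Y' h b₁) (Z' h b b₁) ↔ R (X' g' a') (Y' h' b₁') (Z' h' b' b₁')) := by
    intro g a h b b₁ g' a' h' b' b₁' _ _ _ _ _ _ _ _ _ _ _
    exact hind 2 ![g, K + a, K + b, h, K + b₁, K + b₁] ![g', K + a', K + b', h', K + b₁', K + b₁']
      (by simp [Fin.forall_fin_succ]; omega) (by simp [Fin.forall_fin_succ]; omega)
      (by simp [Fin.forall_fin_succ]; omega)
  clear_value X' Y' Z'
  clear hind hmono hlt hx₀ hy₀ hdiag hupper hz₀
  -- The projection has value one at `(a, a + δ)` and zero at `(a, a + (1 - δ))`.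
  obtain ⟨δ, hδ, hone, hzero⟩ : ∃ δ : ℕ, δ ≤ 1 ∧
      (∀ g a, g < K → a + 1 < 3 * K → R (X' g a) (Y' g (a + δ)) (Z' g a (a + δ))) ∧
      (∀ g a z, g < K → a + 1 < 3 * K → ¬ R (X' g a) (Y' g (a + (1 - δ))) z) := by
    by_cases hv : v
    · refine ⟨0, by omega, fun g a hg ha => hZw _ _ _ ((hS₁ g a hg (by omega)).2 hv),
        fun g a z hg ha hR => ?_⟩
      exact (hS₂ g a (a + 1) hg (by omega) ha).1 ⟨z, hR⟩ hv
    · refine ⟨1, by omega, fun g a hg ha => hZw _ _ _ ((hS₂ g a (a + 1) hg (by omega) ha).2 hv),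
        fun g a z hg ha hR => ?_⟩
      exact hv ((hS₁ g a hg (by omega)).1 ⟨z, hR⟩)
  have hτ : ∀ n < K, swapDigits m n < K := fun n hn => swapDigits_lt hn
  have hττ : ∀ n < K, swapDigits m (swapDigits m n) = n := fun n hn => swapDigits_swapDigits hn
  -- Distinct second coordinates are spaced out, to leave room for their neighbours.
  have hZinv : ∀ s s' g a h b g' a' h' b', s + δ ≤ 2 → s' + δ ≤ 2 → IsGeneric K g a h b →
      IsGeneric K g' a' h' b' → (g < h ↔ g' < h') → (a < b ↔ a' < b') →
      (Z' g (3 * a + s) (3 * a + s + δ) < Z' h (3 * b + s) (3 * b + s + δ) ↔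
        Z' g' (3 * a' + s') (3 * a' + s' + δ) < Z' h' (3 * b' + s') (3 * b' + s' + δ)) := by
    intro s s' g a h b g' a' h' b' hs hs' hG hG' h1 h2
    simp only [IsGeneric] at hG hG'
    apply hZlt <;> omega
  rcases followsFst_or_followsSnd hK3 (fun g a => Z' g (3 * a + 1) (3 * a + 1 + δ))
    (fun g a h b g' a' h' b' => hZinv 1 1 g a h b g' a' h' b' (by omega) (by omega)) with hF | hF
  · -- The witnesses are attached to the rows.
    obtain ⟨ε, v', hε, h₁, h₂⟩ : ∃ (ε : ℕ) (v' : Prop), ε ≤ 1 ∧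
        (∀ g a, g < K → a < K → (R (X' g (3 * a + 1)) (Y' g (3 * a + 1 + ε))
          (Z' g (3 * a + 1) (3 * a + 1 + δ)) ↔ v')) ∧
        ∀ g a h b, g < h → h < K → a < b → b < K → (R (X' g (3 * a + 1)) (Y' h (3 * b + 1 + ε))
          (Z' g (3 * a + 1) (3 * a + 1 + δ)) ↔ ¬ v') := by
      have hup : ∀ ε ≤ 1, ∀ g a h b, g < h → h < K → a < b → b < K →
          (R (X' g (3 * a + 1)) (Y' h (3 * b + 1 + ε)) (Z' g (3 * a + 1) (3 * a + 1 + δ)) ↔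
            R (X' 0 1) (Y' 1 4) (Z' 0 1 (1 + δ))) := by
        intro ε hε g a h b _ _ _ _
        apply hRrow <;> omega
      by_cases hw : R (X' 0 1) (Y' 1 4) (Z' 0 1 (1 + δ))
      · refine ⟨1 - δ, False, by omega, fun g a hg ha => ?_, fun g a h b h1 h2 h3 h4 => ?_⟩
        · exact iff_of_false (hzero _ _ _ hg (by omega)) id
        · rw [hup (1 - δ) (by omega) g a h b h1 h2 h3 h4]; tauto
      · refine ⟨δ, True, hδ, fun g a hg ha => ?_, fun g a h b h1 h2 h3 h4 => ?_⟩
        · exact iff_of_true (hone _ _ hg (by omega)) trivial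
        · rw [hup δ hδ g a h b h1 h2 h3 h4]; tauto
    refine ⟨fun n => X' n (3 * swapDigits m n + 1), fun n => Y' (swapDigits m n) (3 * n + 1 + ε),
      fun n => Z' n (3 * swapDigits m n + 1) (3 * swapDigits m n + 1 + δ), ?_, ?_,
      hF.isStrictOrConst, Or.inl ?_⟩
    · intro n n' hn
      have h1 := hτ n n.2
      have h2 := hτ n' n'.2
      exact hX _ _ _ _ hn n'.2 (by omega) (by omega)
    · intro n n' hn
      have h1 : (n : ℕ) < n' := hn
      have h2 := n'.2
      exact hY _ _ _ _ (by omega) (by omega) (hτ n n.2) (hτ n' n'.2)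
    · refine hasGridRank_of_triangular (v := v') (fun n k => R (X' n (3 * swapDigits m n + 1))
        (Y' (swapDigits m k) (3 * k + 1 + ε))
        (Z' n (3 * swapDigits m n + 1) (3 * swapDigits m n + 1 + δ))) ?_ ?_
      · intro n hn
        simp only [hττ n hn]
        exact h₁ _ _ hn (hτ n hn)
      · intro n n' hnn hn' hlt
        simp only [hττ n' hn']
        exact h₂ _ _ _ _ hnn hn' hlt (hτ n' hn')
  · -- The witnesses are attached to the columns.
    obtain ⟨s, v', hs, h₁, h₂⟩ : ∃ (s : ℕ) (v' : Prop), s + δ ≤ 2 ∧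
        (∀ g a, g < K → a < K → (R (X' g (3 * a + 1)) (Y' g (3 * a + s + δ))
          (Z' g (3 * a + s) (3 * a + s + δ)) ↔ v')) ∧
        ∀ g a h b, g < h → h < K → a < b → b < K → (R (X' g (3 * a + 1)) (Y' h (3 * b + s + δ))
          (Z' h (3 * b + s) (3 * b + s + δ)) ↔ ¬ v') := by
      have hup : ∀ s, s + δ ≤ 2 → ∀ g a h b, g < h → h < K → a < b → b < K →
          (R (X' g (3 * a + 1)) (Y' h (3 * b + s + δ)) (Z' h (3 * b + s) (3 * b + s + δ)) ↔
            R (X' 0 1) (Y' 1 (5 + δ)) (Z' 1 5 (5 + δ))) := by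
        intro s hs g a h b _ _ _ _
        apply hRcol <;> omega
      by_cases hw : R (X' 0 1) (Y' 1 (5 + δ)) (Z' 1 5 (5 + δ))
      · refine ⟨2 - 2 * δ, False, by omega, fun g a hg ha => ?_, fun g a h b h1 h2 h3 h4 => ?_⟩
        · have : 3 * a + (2 - 2 * δ) + δ = 3 * a + 1 + (1 - δ) := by omega
          rw [this]
          exact iff_of_false (hzero _ _ _ hg (by omega)) id
        · rw [hup (2 - 2 * δ) (by omega) g a h b h1 h2 h3 h4]; tauto
      · refine ⟨1, True, by omega, fun g a hg ha => ?_, fun g a h b h1 h2 h3 h4 => ?_⟩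
        · exact iff_of_true (hone _ _ hg (by omega)) trivial
        · rw [hup 1 (by omega) g a h b h1 h2 h3 h4]; tauto
    have hF' : FollowsSnd K fun g a => Z' g (3 * a + s) (3 * a + s + δ) := by
      have ht : ∀ g a h b, IsGeneric K g a h b → _ := fun g a h b hG =>
        hZinv s 1 g a h b g a h b hs (by omega) hG hG Iff.rfl Iff.rfl
      have ht' : ∀ g a h b, IsGeneric K g a h b → IsGeneric K h b g a := fun g a h b hG =>
        ⟨hG.2.2.1, hG.2.2.2.1, hG.1, hG.2.1, hG.2.2.2.2.1.symm, hG.2.2.2.2.2.symm⟩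
      rcases hF with hF | hF
      · exact Or.inl fun g a h b hG hab => (ht _ _ _ _ hG).2 (hF _ _ _ _ hG hab)
      · exact Or.inr fun g a h b hG hab => (ht _ _ _ _ (ht' _ _ _ _ hG)).2 (hF _ _ _ _ hG hab)
    refine ⟨fun n => X' n (3 * swapDigits m n + 1), fun n => Y' (swapDigits m n) (3 * n + s + δ),
      fun n => Z' (swapDigits m n) (3 * n + s) (3 * n + s + δ), ?_, ?_,
      hF'.isStrictOrConst, Or.inr ?_⟩
    · intro n n' hn
      have h1 := hτ n n.2
      have h2 := hτ n' n'.2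
      exact hX _ _ _ _ hn n'.2 (by omega) (by omega)
    · intro n n' hn
      have h1 : (n : ℕ) < n' := hn
      have h2 := n'.2
      exact hY _ _ _ _ (by omega) (by omega) (hτ n n.2) (hτ n' n'.2)
    · refine hasGridRank_of_triangular (v := v') (fun n k => R (X' n (3 * swapDigits m n + 1))
        (Y' (swapDigits m k) (3 * k + s + δ))
        (Z' (swapDigits m k) (3 * k + s) (3 * k + s + δ))) ?_ ?_
      · intro n hn
        simp only [hττ n hn]
        exact h₁ _ _ hn (hτ n hn)
      · intro n n' hnn hn' hlt
        simp only [hττ n' hn']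
        exact h₂ _ _ _ _ hnn hn' hlt (hτ n' hn')

/-! ### Quantifying out a coordinate -/

theorem HasGridRank.swap {α β : Type*} [LinearOrder α] [LinearOrder β] {M : Set (α × β)} {e : ℕ}
    (h : HasGridRank M e) : HasGridRank {p : β × α | (p.2, p.1) ∈ M} e := by
  obtain ⟨I, J, hI, hJ, hcell⟩ := h
  exact ⟨J, I, hJ, hI, fun j i => ⟨(hcell i j).2, (hcell i j).1⟩⟩

theorem HasGridRank.exists_row_ne {α β : Type*} [LinearOrder α] [LinearOrder β] {M : Set (α × β)}
    {e : ℕ} (h : HasGridRank M e) (he : 2 ≤ e) :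
    ∃ a a' b, (a, b) ∈ M ∧ (a', b) ∉ M := by
  obtain ⟨I, J, -, -, hcell⟩ := h
  by_contra! hcon
  have hsub : (cellRows M (I ⟨0, by omega⟩) (J ⟨0, by omega⟩)).Subsingleton := by
    rintro _ ⟨a, -, rfl⟩ _ ⟨a', -, rfl⟩
    ext b
    exact and_congr_right fun _ => ⟨hcon a a' b, hcon a' a b⟩
  have h1 : (e : ℕ∞) ≤ 1 :=
    (hcell ⟨0, by omega⟩ ⟨0, by omega⟩).1.trans (Set.encard_le_one_iff_subsingleton.2 hsub)
  have : e ≤ 1 := by exact_mod_cast h1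
  omega

theorem IsStrictOrConst.comp_strictMono {n n' : ℕ} {γ : Type*} [Preorder γ] {f : Fin n → γ}
    (hf : IsStrictOrConst f) {x : Fin n' → Fin n} (hx : StrictMono x) :
    IsStrictOrConst fun a => f (x a) := by
  rcases hf with hf | hf | hf
  · exact Or.inl (hf.comp hx)
  · exact Or.inr (Or.inl fun a b => hf _ _)
  · exact Or.inr (Or.inr (hf.comp_strictMono hx))

/-- A projected grid whose rows and columns are given by full tuples `u a`, `v b`. Injectivity of
the two sequences is ensured by a coordinate on each side that is not constant. -/
theorem hasProjectedGridRank_of_full {n k p q e : ℕ} {R : Set (Fin k → Fin n)} (A : Finset (Fin k))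
    (u : Fin p → Fin k → Fin n) (v : Fin q → Fin k → Fin n)
    (hu : ∀ c ∈ A, IsStrictOrConst fun a => u a c) (hv : ∀ c ∉ A, IsStrictOrConst fun b => v b c)
    (hu' : ∃ c ∈ A, Function.Injective fun a => u a c)
    (hv' : ∃ c ∉ A, Function.Injective fun b => v b c)
    (h : HasGridRank {x : Fin p × Fin q | (fun c => if c ∈ A then u x.1 c else v x.2 c) ∈ R} e) :
    HasProjectedGridRank R e := by
  obtain ⟨c, hc, huc⟩ := hu'
  obtain ⟨c', hc', hvc⟩ := hv'
  refine ⟨A, p, q, fun a c => u a c, fun b c => v b c, ⟨fun a a' haa => huc ?_, fun c => hu c c.2⟩,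
    ⟨fun b b' hbb => hvc ?_, fun c => hv c c.2⟩, ?_⟩
  · exact congrFun haa ⟨c, hc⟩
  · exact congrFun hbb ⟨c', hc'⟩
  · exact h

/-- The cylindrification of `R` along the coordinate `l`: the tuples that can be brought into `R`
by changing the entry at `l`. -/
def cylinder {n k : ℕ} (l : Fin k) (R : Set (Fin k → Fin n)) : Set (Fin k → Fin n) :=
  {x | ∃ z, Function.update x l z ∈ R}

section attach

variable {n k p q N e : ℕ} {R : Set (Fin k → Fin n)} {A : Finset (Fin k)} {l : Fin k}
  {s : Fin p → {x // x ∈ A} → Fin n} {t : Fin q → {x // x ∉ A} → Fin n}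
  {x : Fin N → Fin p} {y : Fin N → Fin q} {z : Fin N → Fin n}

/-- Attaching the values of the coordinate `l` to the rows. -/
theorem hasProjectedGridRank_of_attach_row
    (hs : ∀ c, IsStrictOrConst fun a => s a c) (ht : ∀ c, IsStrictOrConst fun b => t b c)
    (hs' : ∃ c : {x // x ∈ A}, (c : Fin k) ≠ l ∧ Function.Injective fun a => s a c)
    (ht' : ∃ c : {x // x ∉ A}, (c : Fin k) ≠ l ∧ Function.Injective fun b => t b c)
    (hx : StrictMono x) (hy : StrictMono y) (hz : IsStrictOrConst z)
    (h : HasGridRank {i : Fin N × Fin N |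
      Function.update (glue A (s (x i.1)) (t (y i.2))) l (z i.1) ∈ R} e) :
    HasProjectedGridRank R e := by
  refine hasProjectedGridRank_of_full (insert l A)
    (fun i => Function.update (glue A (s (x i)) (t (y i))) l (z i))
    (fun i => glue A (s (x i)) (t (y i))) ?_ ?_ ?_ ?_ ?_
  · intro c hc
    by_cases hcl : c = l
    · subst hcl; simpa using hz
    · have hcA : c ∈ A := (Finset.mem_insert.1 hc).resolve_left hcl
      simpa [hcl, glue, hcA] using (hs ⟨c, hcA⟩).comp_strictMono hx
  · intro c hc
    have hcA : c ∉ A := fun h => hc (Finset.mem_insert_of_mem h)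
    simpa [glue, hcA] using (ht ⟨c, hcA⟩).comp_strictMono hy
  · obtain ⟨⟨c, hcA⟩, hcl, hinj⟩ := hs'
    refine ⟨c, Finset.mem_insert_of_mem hcA, ?_⟩
    simp only at hcl
    simpa [hcl, glue, hcA, Function.comp_def] using hinj.comp hx.injective
  · obtain ⟨⟨c, hcA⟩, hcl, hinj⟩ := ht'
    refine ⟨c, by simp only at hcl; simp [hcl, hcA], ?_⟩
    simpa [glue, hcA, Function.comp_def] using hinj.comp hy.injective
  · convert h using 5 with i
    rename_i c
    by_cases hcl : c = l
    · subst hcl; simp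
    · by_cases hcA : c ∈ A <;> simp [hcl, glue, hcA]

/-- Attaching the values of the coordinate `l` to the columns. -/
theorem hasProjectedGridRank_of_attach_col
    (hs : ∀ c, IsStrictOrConst fun a => s a c) (ht : ∀ c, IsStrictOrConst fun b => t b c)
    (hs' : ∃ c : {x // x ∈ A}, (c : Fin k) ≠ l ∧ Function.Injective fun a => s a c)
    (ht' : ∃ c : {x // x ∉ A}, (c : Fin k) ≠ l ∧ Function.Injective fun b => t b c)
    (hx : StrictMono x) (hy : StrictMono y) (hz : IsStrictOrConst z)
    (h : HasGridRank {i : Fin N × Fin N |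
      Function.update (glue A (s (x i.1)) (t (y i.2))) l (z i.2) ∈ R} e) :
    HasProjectedGridRank R e := by
  refine hasProjectedGridRank_of_full (A.erase l)
    (fun i => glue A (s (x i)) (t (y i)))
    (fun i => Function.update (glue A (s (x i)) (t (y i))) l (z i)) ?_ ?_ ?_ ?_ ?_
  · intro c hc
    have hcA : c ∈ A := Finset.mem_of_mem_erase hc
    simpa [glue, hcA] using (hs ⟨c, hcA⟩).comp_strictMono hx
  · intro c hc
    by_cases hcl : c = l
    · subst hcl; simpa using hz
    · have hcA : c ∉ A := fun h => hc (Finset.mem_erase.2 ⟨hcl, h⟩)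
      simpa [hcl, glue, hcA] using (ht ⟨c, hcA⟩).comp_strictMono hy
  · obtain ⟨⟨c, hcA⟩, hcl, hinj⟩ := hs'
    refine ⟨c, Finset.mem_erase.2 ⟨hcl, hcA⟩, ?_⟩
    simpa [glue, hcA, Function.comp_def] using hinj.comp hx.injective
  · obtain ⟨⟨c, hcA⟩, hcl, hinj⟩ := ht'
    refine ⟨c, fun h => hcA (Finset.mem_of_mem_erase h), ?_⟩
    simp only at hcl
    simpa [hcl, glue, hcA, Function.comp_def] using hinj.comp hy.injective
  · convert h using 5 with i
    rename_i c
    by_cases hcl : c = l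
    · subst hcl; simp
    · by_cases hcA : c ∈ A <;> simp [hcl, glue, hcA]

end attach

theorem IsStrictOrConst.injective {n : ℕ} {γ : Type*} [PartialOrder γ] {f : Fin n → γ}
    (hf : IsStrictOrConst f) {a b : Fin n} (hab : f a ≠ f b) : Function.Injective f := by
  rcases hf with hf | hf | hf
  · exact hf.injective
  · exact absurd (hf a b) hab
  · exact hf.injective

/-- Quantifying out one coordinate increases the projected grid-rank in a bounded way. -/
theorem exists_projectedGridRankLE_cylinder : ∃ g : ℕ → ℕ, ∀ (d k n : ℕ) (R : Set (Fin k → Fin n))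
    (l : Fin k), ProjectedGridRankLE R d → ProjectedGridRankLE (cylinder l R) (g d) := by
  choose N₂ hN₂ using fun d : ℕ => hasGridRank_of_hasPattern (m := d + 2) (by omega)
  choose N₁ hN₁ using fun d : ℕ => exists_hasPattern (N₂ d)
  refine ⟨fun d => N₁ d + 1, fun d k n R l hR e he => ?_⟩
  by_contra! hlt
  obtain ⟨A, p, q, s, t, ⟨-, hs⟩, ⟨-, ht⟩, hgrid⟩ := he
  set R₃ : Fin p → Fin q → Fin n → Prop :=
    fun a b z => Function.update (glue A (s a) (t b)) l z ∈ R with hR₃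
  have hgrid' : HasGridRank {i : Fin p × Fin q | ∃ z, R₃ i.1 i.2 z} e := hgrid
  -- Distinct rows force a coordinate other than `l` that is not constant on the rows.
  have hs' : ∃ c : {x // x ∈ A}, (c : Fin k) ≠ l ∧ Function.Injective fun a => s a c := by
    obtain ⟨a, a', b, ⟨z, hz⟩, hnot⟩ := hgrid'.exists_row_ne (by omega)
    by_contra! hcon
    refine hnot ⟨z, ?_⟩
    have : Function.update (glue A (s a') (t b)) l z =
        Function.update (glue A (s a) (t b)) l z := by
      funext c
      by_cases hcl : c = l
      · subst hcl; simp
      · by_cases hcA : c ∈ A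
        · have : s a' ⟨c, hcA⟩ = s a ⟨c, hcA⟩ := by
            by_contra hne
            exact hcon ⟨c, hcA⟩ hcl (IsStrictOrConst.injective (hs ⟨c, hcA⟩) hne)
          simp [hcl, glue, hcA, this]
        · simp [hcl, glue, hcA]
    simp only [hR₃, this]
    exact hz
  have ht' : ∃ c : {x // x ∉ A}, (c : Fin k) ≠ l ∧ Function.Injective fun b => t b c := by
    obtain ⟨b, b', a, ⟨z, hz⟩, hnot⟩ := hgrid'.swap.exists_row_ne (by omega)
    by_contra! hcon
    refine hnot ⟨z, ?_⟩
    have : Function.update (glue A (s a) (t b')) l z =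
        Function.update (glue A (s a) (t b)) l z := by
      funext c
      by_cases hcl : c = l
      · subst hcl; simp
      · by_cases hcA : c ∈ A
        · simp [hcl, glue, hcA]
        · have : t b' ⟨c, hcA⟩ = t b ⟨c, hcA⟩ := by
            by_contra hne
            exact hcon ⟨c, hcA⟩ hcl (IsStrictOrConst.injective (ht ⟨c, hcA⟩) hne)
          simp [hcl, glue, hcA, this]
    simp only [hR₃, this]
    exact hz
  have hrank : HasProjectedGridRank R (d + 2) := by
    obtain ⟨v, hpat | hpat⟩ := hN₁ d _ e (by omega) hgrid'
    · obtain ⟨x, y, z, hx, hy, hz, h | h⟩ := hN₂ d R₃ v hpat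
      · exact hasProjectedGridRank_of_attach_row hs ht hs' ht' hx hy hz h
      · exact hasProjectedGridRank_of_attach_col hs ht hs' ht' hx hy hz h
    · obtain ⟨y, x, z, hy, hx, hz, h | h⟩ := hN₂ d (fun b a z => R₃ a b z) v hpat
      · exact hasProjectedGridRank_of_attach_col hs ht hs' ht' hx hy hz h.swap
      · exact hasProjectedGridRank_of_attach_row hs ht hs' ht' hx hy hz h.swap
  have := hR _ hrank
  omega

/-- Quantifying out all coordinates in `U`, one at a time. -/
theorem projectedGridRankLE_iterate {g : ℕ → ℕ}
    (hg : ∀ (d k n : ℕ) (R : Set (Fin k → Fin n)) (l : Fin k),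
      ProjectedGridRankLE R d → ProjectedGridRankLE (cylinder l R) (g d))
    {d k n : ℕ} {R : Set (Fin k → Fin n)} (hR : ProjectedGridRankLE R d) (U : Finset (Fin k)) :
    ProjectedGridRankLE {x : Fin k → Fin n | ∃ y ∈ R, ∀ c ∉ U, y c = x c} (g^[U.card] d) := by
  induction U using Finset.induction_on with
  | empty =>
    have : {x : Fin k → Fin n | ∃ y ∈ R, ∀ c ∉ (∅ : Finset (Fin k)), y c = x c} = R := by
      ext x
      constructor
      · rintro ⟨y, hy, hyx⟩
        rwa [← funext fun c => hyx c (by simp)]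
      · exact fun hx => ⟨x, hx, fun _ _ => rfl⟩
    rw [this]
    exact hR
  | insert l U hl ih =>
    have : {x : Fin k → Fin n | ∃ y ∈ R, ∀ c ∉ insert l U, y c = x c} =
        cylinder l {x : Fin k → Fin n | ∃ y ∈ R, ∀ c ∉ U, y c = x c} := by
      ext x
      constructor
      · rintro ⟨y, hy, hyx⟩
        refine ⟨y l, y, hy, fun c hc => ?_⟩
        by_cases hcl : c = l
        · subst hcl; simp
        · rw [Function.update_of_ne hcl]
          exact hyx c (by simp [hcl, hc])
      · rintro ⟨z, y, hy, hyx⟩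
        refine ⟨y, hy, fun c hc => ?_⟩
        simp only [Finset.mem_insert, not_or] at hc
        rw [hyx c hc.2, Function.update_of_ne hc.1]
    rw [this, Finset.card_insert_of_notMem hl, Function.iterate_succ_apply']
    exact hg _ _ _ _ _ ih

end GridRank

theorem mainTheorem4 :
    ∃ f : ℕ → ℕ → ℕ, ∀ (d k n : ℕ) (R : Set (Fin k → Fin n)),
      GridRank.ProjectedGridRankLE R d →
        ∀ i j : Fin k, i ≠ j →
          GridRank.GridRankLE (GridRank.binaryProjection i j R) (f d k) := by
  obtain ⟨g, hg⟩ := GridRank.exists_projectedGridRankLE_cylinder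
  refine ⟨fun d k => g^[k - 2] d, fun d k n R hR i j hij e he => ?_⟩
  have hU : ((Finset.univ.erase i).erase j).card = k - 2 := by
    rw [Finset.card_erase_of_mem (by simp [hij.symm]), Finset.card_erase_of_mem (by simp)]
    simp only [Finset.card_univ, Fintype.card_fin]
    omega
  have := GridRank.projectedGridRankLE_iterate hg hR ((Finset.univ.erase i).erase j)
  rw [hU] at this
  refine this e (GridRank.hasProjectedGridRank_of_full {i} (fun a _ => a) (fun b _ => b)
    (fun _ _ => Or.inl strictMono_id) (fun _ _ => Or.inl strictMono_id)
    ⟨i, by simp, Function.injective_id⟩ ⟨j, by simp [hij.symm], Function.injective_id⟩ ?_)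
  convert he using 1
  ext ⟨a, b⟩
  constructor
  · rintro ⟨y, hy, hyc⟩
    refine ⟨y, hy, Prod.ext ?_ ?_⟩
    · simpa using hyc i (by simp)
    · simpa [hij.symm] using hyc j (by simp)
  · rintro ⟨y, hy, hyab⟩
    simp only [Prod.mk.injEq] at hyab
    refine ⟨y, hy, fun c hc => ?_⟩
    by_cases hci : c = i
    · subst hci; simpa using hyab.1
    · have hcj : c = j := by
        by_contra hcj
        exact hc (by simp [hci, hcj])
      subst hcj
      simpa [hci] using hyab.2
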